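/- An arithmetic circuit over a field $\mathbb{F}$ in variables $x_1,\dots,x_n$ is a finite directed acyclic graph (parallel edges allowed) whose vertices, called gates, are labelled as follows: every gate of in-degree zero is labelled by a variable or by an element of $\mathbb{F}$, and every other gate is labelled by $+$ or $\times$ and computes the sum, respectively the product, of the polynomials computed at the tails of its incoming edges (counted with multiplicity). The circuit computes a polynomial $f$ if $f$ is the polynomial computed at one of its gates of out-degree zero. Its size is its number of edges. There is a polynomial $\Phi$ in three variables with coefficients in $\mathbb{N}$ such that the following holds for all natural numbers $s,n,d$ and every field $\mathbb{F}$ with more than $d^2$ elements (in particular, for every field of characteristic zero or of characteristic greater than $d^2$). Let $f\in\mathbb{F}[x_1,\dots,x_n]$ be a polynomial of total degree $d$ that can be computed by an arithmetic circuit over $\mathbb{F}$ of size at most $s$. If $g,h\in\mathbb{F}[x_1,\dots,x_n]$ are polynomials of total degree at least $1$ with $f=g\cdot h$ and $\mathsf{GCD}(g,h)=1$ (that is, every common divisor of $g$ and $h$ in $\mathbb{F}[x_1,\dots,x_n]$ is a nonzero constant), then each of $g$ and $h$ can be computed by an arithmetic circuit over $\mathbb{F}$ of size at most $\Phi(s,n,d)$.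 -/

import Mathlib

/-- The label and the incoming edges of one gate of a circuit whose gates are indexed by `V`. A gate
is labelled by a variable `x_0, …, x_{n-1}`, by a constant in `F`, by `+` or by `×`; sum and product gates carry the multiset of the gates that have an edge into
them (parallel edges are allowed, so that `u * u` is a single product gate with two edges). -/
inductive Gate (F : Type*) (n : ℕ) (V : Type) where
  | var (i : Fin n)
  | const (c : F)
  | sum (l : Multiset V)
  | prod (l : Multiset V)

/-- The gates that have an edge into the given gate, with multiplicity. -/
def Gate.inputs {F : Type*} {n : ℕ} {V : Type} : Gate F n V → Multiset V
  | .var _ => 0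
  | .const _ => 0
  | .sum l => l
  | .prod l => l

/-- An arithmetic circuit over the field `F` in the variables `x_0, …, x_{n-1}`: a finite directed
acyclic graph whose vertices are labelled gates, the input gates (variables and constants) being
exactly those of in-degree zero. -/
structure ArithCircuit (F : Type*) (n : ℕ) where
  /-- the vertices -/
  V : Type
  /-- there are finitely many of them -/
  fintypeV : Fintype V
  /-- the gate sitting at each vertex, together with its incoming edges -/
  gate : V → Gate F n V
  /-- sum gates are not input gates -/
  sum_ne_zero : ∀ v l, gate v = Gate.sum l → l ≠ 0
  /-- product gates are not input gates -/
  prod_ne_zero : ∀ v l, gate v = Gate.prod l → l ≠ 0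
  /-- there is no directed cycle -/
  acyclic : ∀ v, ¬ Relation.TransGen (fun u w => u ∈ (gate w).inputs) v v

namespace ArithCircuit

/-- `C.Edge u w`: there is an edge from `u` to `w`. -/
def Edge {F : Type*} {n : ℕ} (C : ArithCircuit F n) (u w : C.V) : Prop :=
  u ∈ (C.gate w).inputs

theorem wellFounded_edge {F : Type*} {n : ℕ} (C : ArithCircuit F n) : WellFounded C.Edge := by
  have := C.fintypeV
  have : Std.Irrefl (Relation.TransGen C.Edge) := ⟨C.acyclic⟩
  have h : WellFounded (Relation.TransGen C.Edge) := Finite.wellFounded_of_trans_of_irrefl _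
  exact Subrelation.wf (fun hab => Relation.TransGen.single hab) h

/-- The polynomial computed at a gate, from those computed at the gates with an edge into it. -/
noncomputable def gatePoly {F : Type*} [Field F] {n : ℕ} {V : Type} :
    (g : Gate F n V) → ((u : V) → u ∈ g.inputs → MvPolynomial (Fin n) F) →
      MvPolynomial (Fin n) F
  | .var i, _ => MvPolynomial.X i
  | .const c, _ => MvPolynomial.C c
  | .sum l, p => (l.attach.map fun u => p u.1 u.2).sum
  | .prod l, p => (l.attach.map fun u => p u.1 u.2).prod

/-- The polynomial computed at the gate `v` of the circuit `C`. -/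
noncomputable def eval {F : Type*} [Field F] {n : ℕ} (C : ArithCircuit F n) :
    C.V → MvPolynomial (Fin n) F :=
  C.wellFounded_edge.fix fun w p => gatePoly (C.gate w) p

theorem eval_eq {F : Type*} [Field F] {n : ℕ} (C : ArithCircuit F n) (w : C.V) :
    C.eval w = gatePoly (C.gate w) fun u _ => C.eval u :=
  C.wellFounded_edge.fix_eq _ w

theorem eval_var {F : Type*} [Field F] {n : ℕ} (C : ArithCircuit F n) {w : C.V} {i : Fin n}
    (h : C.gate w = Gate.var i) : C.eval w = MvPolynomial.X i := by
  rw [eval_eq, h]; rfl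

theorem eval_const {F : Type*} [Field F] {n : ℕ} (C : ArithCircuit F n) {w : C.V} {c : F}
    (h : C.gate w = Gate.const c) : C.eval w = MvPolynomial.C c := by
  rw [eval_eq, h]; rfl

theorem eval_sum {F : Type*} [Field F] {n : ℕ} (C : ArithCircuit F n) {w : C.V}
    {l : Multiset C.V} (h : C.gate w = Gate.sum l) : C.eval w = (l.map C.eval).sum := by
  rw [eval_eq, h]
  exact congrArg Multiset.sum (Multiset.attach_map_val' l C.eval)

theorem eval_prod {F : Type*} [Field F] {n : ℕ} (C : ArithCircuit F n) {w : C.V}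
    {l : Multiset C.V} (h : C.gate w = Gate.prod l) : C.eval w = (l.map C.eval).prod := by
  rw [eval_eq, h]
  exact congrArg Multiset.prod (Multiset.attach_map_val' l C.eval)

/-- The size of a circuit: its number of edges. -/
def size {F : Type*} {n : ℕ} (C : ArithCircuit F n) : ℕ :=
  haveI := C.fintypeV
  ∑ v : C.V, (C.gate v).inputs.card

/-- An output gate is a gate of out-degree zero. -/
def IsOutput {F : Type*} {n : ℕ} (C : ArithCircuit F n) (v : C.V) : Prop :=
  ∀ w, ¬ C.Edge v w

/-- `C` computes `f` if `f` is the polynomial computed at one of its output gates. -/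
def Computes {F : Type*} [Field F] {n : ℕ} (C : ArithCircuit F n)
    (f : MvPolynomial (Fin n) F) : Prop :=
  ∃ v, C.IsOutput v ∧ C.eval v = f

end ArithCircuit

/-- `f` can be computed by an arithmetic circuit of size at most `s`. -/
def HasCircuitOfSize {F : Type*} [Field F] {n : ℕ} (f : MvPolynomial (Fin n) F) (s : ℕ) : Prop :=
  ∃ C : ArithCircuit F n, C.Computes f ∧ C.size ≤ s

/-!
Write `p` and `q` for the total degrees of the factors `g` and `h`. Take a direction `a` at which
the leading forms of `g` and `h` do not vanish. Then `g (x + y a)` and `h (x + y a)` have constant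
leading coefficients in `y`, and they are still coprime, because `x ↦ x + y a` is invertible. Their
resultant with respect to `y` is therefore a nonzero polynomial in `x`, and its degree is at most
`(p + q) ^ 2 = d ^ 2`, so it does not vanish at some point `b` of a field with more than `d ^ 2`
elements: `g (b + y a)` and `h (b + y a)` are coprime polynomials over the field, of degrees `p` and
`q` (`exists_line_isCoprime`).

Substitute `b + t (x - b) + y a` for `x` in `f = g h` and expand in powers of `t`, which gives
`f = ∑ f_k t ^ k` and likewise `g_k`, `h_k`, polynomials in `y` over the polynomials in `x`. The
terms of order `0` are the restrictions to the line, and for `k ≥ 1` the polynomials `g_k` and `h_k`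
have degrees less than `p` and `q` in `y` and satisfy
`g_0 h_k + h_0 g_k = f_k - ∑_{0 < i < k} g_i h_{k - i}`. As `g_0` and `h_0` are coprime with scalar
coefficients, this is a uniquely solvable linear system with scalar matrix: the coefficients of
`g_k` and `h_k` are linear combinations of those of the right-hand side
(`Polynomial.exists_coeff_eq_sum_of_isCoprime`). This Hensel lifting needs neither derivatives nor
divisions by integers, so the characteristic plays no role. It takes polynomially many operations to
obtain all coefficients of `g` and `h` from those of `f` (`Polynomial.derives_coeff_of_mul`), and
those of `f` are found by interpolation from the values of `f` at scalar `t` and `y`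
(`Derives.coeff_plane`). The factor `g` itself is the value at `t = 1`, `y = 0`
(`eq_sum_coeff_plane`).

Operations are counted by straight-line derivations with free variables and constants (`Derives`).
These agree with circuits up to a constant factor in the size (`HasCircuitOfSize.derives`,
`Derives.hasCircuitOfSize`) and compose and transform under ring homomorphisms more easily.
-/

/-! ### Straight-line derivations -/

/-- `Chain S m T`: starting from the set `S` of elements that are available for free, `m` additions
and multiplications of elements already obtained lead to the set `T`. -/
inductive Chain {R : Type*} [CommSemiring R] (S : Set R) : ℕ → Set R → Prop
  | refl : Chain S 0 S
  | add {m : ℕ} {T : Set R} {a b : R} :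
      Chain S m T → a ∈ T → b ∈ T → Chain S (m + 1) (insert (a + b) T)
  | mul {m : ℕ} {T : Set R} {a b : R} :
      Chain S m T → a ∈ T → b ∈ T → Chain S (m + 1) (insert (a * b) T)

namespace Chain

variable {R R' : Type*} [CommSemiring R] [CommSemiring R'] {S S' T U : Set R} {m m' : ℕ}

theorem subset (h : Chain S m T) : S ⊆ T := by
  induction h with
  | refl => exact subset_rfl
  | add _ _ _ ih => exact ih.trans (Set.subset_insert _ _)
  | mul _ _ _ ih => exact ih.trans (Set.subset_insert _ _)

theorem trans (h : Chain S m T) (h' : Chain T m' U) : Chain S (m + m') U := by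
  induction h' with
  | refl => exact h
  | add _ ha hb ih => exact ih.add ha hb
  | mul _ ha hb ih => exact ih.mul ha hb

theorem mono_left (h : Chain S m T) (hS : S ⊆ S') : Chain S' m (S' ∪ T) := by
  induction h with
  | refl => rw [Set.union_eq_left.2 hS]; exact .refl
  | add _ ha hb ih => rw [Set.union_insert]; exact ih.add (.inr ha) (.inr hb)
  | mul _ ha hb ih => rw [Set.union_insert]; exact ih.mul (.inr ha) (.inr hb)

theorem map (φ : R →+* R') (h : Chain S m T) : Chain (φ '' S) m (φ '' T) := by
  induction h with
  | refl => exact .refl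
  | add _ ha hb ih =>
    rw [Set.image_insert_eq, map_add]
    exact ih.add (Set.mem_image_of_mem _ ha) (Set.mem_image_of_mem _ hb)
  | mul _ ha hb ih =>
    rw [Set.image_insert_eq, map_mul]
    exact ih.mul (Set.mem_image_of_mem _ ha) (Set.mem_image_of_mem _ hb)

end Chain

/-- `Derives S m T`: all elements of `T` can be obtained from those of `S` by at most `m` additions
and multiplications in total, intermediate results being shared. -/
def Derives {R : Type*} [CommSemiring R] (S : Set R) (m : ℕ) (T : Set R) : Prop :=
  ∃ m' ≤ m, ∃ U, Chain S m' U ∧ T ⊆ U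

namespace Derives

variable {R R' : Type*} [CommSemiring R] [CommSemiring R'] {S S' T T' U : Set R} {m m' : ℕ}
  {a b : R}

theorem of_subset (h : T ⊆ S) : Derives S m T := ⟨0, Nat.zero_le _, S, .refl, h⟩

theorem of_mem (h : a ∈ S) : Derives S m {a} := of_subset (Set.singleton_subset_iff.2 h)

theorem mono (h : Derives S m T) (hm : m ≤ m') : Derives S m' T := by
  obtain ⟨k, hk, U, hU, hT⟩ := h
  exact ⟨k, hk.trans hm, U, hU, hT⟩

theorem subset (h : Derives S m T) (hT : T' ⊆ T) : Derives S m T' := by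
  obtain ⟨k, hk, U, hU, hTU⟩ := h
  exact ⟨k, hk, U, hU, hT.trans hTU⟩

theorem mono_left (h : Derives S m T) (hS : S ⊆ S') : Derives S' m T := by
  obtain ⟨k, hk, U, hU, hTU⟩ := h
  exact ⟨k, hk, _, hU.mono_left hS, hTU.trans Set.subset_union_right⟩

theorem trans (h : Derives S m T) (h' : Derives (S ∪ T) m' U) : Derives S (m + m') (T ∪ U) := by
  obtain ⟨k, hk, V, hV, hTV⟩ := h
  obtain ⟨k', hk', W, hW, hUW⟩ := h'.mono_left (Set.union_subset hV.subset hTV)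
  exact ⟨k + k', add_le_add hk hk', W, hV.trans hW, Set.union_subset (hTV.trans hW.subset) hUW⟩

theorem union (h : Derives S m T) (h' : Derives S m' U) : Derives S (m + m') (T ∪ U) :=
  h.trans (h'.mono_left Set.subset_union_left)

theorem biUnion {ι : Type*} (I : Finset ι) {T : ι → Set R} (h : ∀ i ∈ I, Derives S m (T i)) :
    Derives S (I.card * m) (⋃ i ∈ I, T i) := by
  classical
  induction I using Finset.induction_on with
  | empty => exact of_subset (by simp)
  | insert i I hi ih =>
    rw [Finset.set_biUnion_insert, Finset.card_insert_of_notMem hi, add_mul, one_mul, add_comm]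
    exact (h i (by simp)).union (ih fun j hj => h j (by simp [hj]))

theorem map (φ : R →+* R') (h : Derives S m T) : Derives (φ '' S) m (φ '' T) := by
  obtain ⟨k, hk, U, hU, hTU⟩ := h
  exact ⟨k, hk, _, hU.map φ, Set.image_mono hTU⟩

theorem add (h : Derives S m {a}) (h' : Derives S m' {b}) : Derives S (m + m' + 1) {a + b} := by
  obtain ⟨k, hk, U, hU, hTU⟩ := h.union h'
  exact ⟨k + 1, by omega, _, hU.add (hTU (.inl rfl)) (hTU (.inr rfl)), by simp⟩

theorem mul (h : Derives S m {a}) (h' : Derives S m' {b}) : Derives S (m + m' + 1) {a * b} := by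
  obtain ⟨k, hk, U, hU, hTU⟩ := h.union h'
  exact ⟨k + 1, by omega, _, hU.mul (hTU (.inl rfl)) (hTU (.inr rfl)), by simp⟩

theorem sum {ι : Type*} (I : Finset ι) {p : ι → R} (h0 : 0 ∈ S)
    (h : ∀ i ∈ I, Derives S m {p i}) : Derives S (I.card * (m + 1)) {∑ i ∈ I, p i} := by
  classical
  induction I using Finset.induction_on with
  | empty => exact of_mem (by simpa using h0)
  | insert i I hi ih =>
    rw [Finset.sum_insert hi, Finset.card_insert_of_notMem hi]
    refine ((h i (by simp)).add (ih fun j hj => h j (by simp [hj]))).mono ?_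
    rw [add_mul, one_mul]; omega

theorem multiset_sum (h0 : 0 ∈ S) (l : Multiset R) (hl : ∀ a ∈ l, a ∈ S) :
    Derives S l.card {l.sum} := by
  induction l using Multiset.induction_on with
  | empty => exact of_mem (by simpa using h0)
  | cons a l ih =>
    rw [Multiset.sum_cons, Multiset.card_cons]
    exact ((of_mem (m := 0) (hl a (by simp))).add
      (ih fun b hb => hl b (by simp [hb]))).mono (by omega)

theorem multiset_prod (h1 : 1 ∈ S) (l : Multiset R) (hl : ∀ a ∈ l, a ∈ S) :
    Derives S l.card {l.prod} := by
  induction l using Multiset.induction_on with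
  | empty => exact of_mem (by simpa using h1)
  | cons a l ih =>
    rw [Multiset.prod_cons, Multiset.card_cons]
    exact ((of_mem (m := 0) (hl a (by simp))).mul
      (ih fun b hb => hl b (by simp [hb]))).mono (by omega)

end Derives

/-! ### Circuits and straight-line derivations -/

/-- The polynomials that a circuit has for free: the variables and the constants. -/
def inputPolys (F : Type*) [Field F] (n : ℕ) : Set (MvPolynomial (Fin n) F) :=
  Set.range MvPolynomial.X ∪ Set.range MvPolynomial.C

namespace ArithCircuit

variable {F : Type*} {n : ℕ}

/-- Transport of a gate along a map of vertices. -/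
def mapGate {V V' : Type} (e : V → V') : Gate F n V → Gate F n V'
  | .var i => .var i
  | .const c => .const c
  | .sum l => .sum (l.map e)
  | .prod l => .prod (l.map e)

theorem inputs_mapGate {V V' : Type} (e : V → V') (g : Gate F n V) :
    (mapGate e g).inputs = g.inputs.map e := by
  cases g <;> simp [mapGate, Gate.inputs]

/-- The gates of `C.extend g _ _`. -/
def extendGate (C : ArithCircuit F n) (g : Gate F n C.V) : Option C.V → Gate F n (Option C.V)
  | none => mapGate some g
  | some v => mapGate some (C.gate v)

theorem wellFounded_extendGate (C : ArithCircuit F n) (g : Gate F n C.V) :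
    WellFounded fun u w => u ∈ (C.extendGate g w).inputs := by
  have hsome : ∀ v, Acc (fun u w => u ∈ (C.extendGate g w).inputs) (some v) := by
    intro v
    induction v using C.wellFounded_edge.induction with
    | _ v ih =>
    refine ⟨_, fun u hu => ?_⟩
    simp only [extendGate, inputs_mapGate, Multiset.mem_map] at hu
    obtain ⟨u, hu, rfl⟩ := hu
    exact ih u hu
  refine ⟨fun v => ?_⟩
  cases v with
  | some v => exact hsome v
  | none =>
    refine ⟨_, fun u hu => ?_⟩
    simp only [extendGate, inputs_mapGate, Multiset.mem_map] at hu
    obtain ⟨u, hu, rfl⟩ := hu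
    exact hsome u

/-- The circuit `C` with one more gate, `g`, fed by gates of `C`. -/
def extend (C : ArithCircuit F n) (g : Gate F n C.V) (hs : ∀ l, g = .sum l → l ≠ 0)
    (hp : ∀ l, g = .prod l → l ≠ 0) : ArithCircuit F n where
  V := Option C.V
  fintypeV := haveI := C.fintypeV; inferInstance
  gate := C.extendGate g
  sum_ne_zero := by
    have key : ∀ g' : Gate F n C.V, (∀ l, g' = .sum l → l ≠ 0) →
        ∀ l, mapGate some g' = .sum l → l ≠ 0 := by
      rintro (_ | _ | l' | _) h l hl <;> simp [mapGate] at hl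
      subst hl
      simpa using h l' rfl
    rintro (_ | v)
    · exact key g hs
    · exact key (C.gate v) (C.sum_ne_zero v)
  prod_ne_zero := by
    have key : ∀ g' : Gate F n C.V, (∀ l, g' = .prod l → l ≠ 0) →
        ∀ l, mapGate some g' = .prod l → l ≠ 0 := by
      rintro (_ | _ | _ | l') h l hl <;> simp [mapGate] at hl
      subst hl
      simpa using h l' rfl
    rintro (_ | v)
    · exact key g hp
    · exact key (C.gate v) (C.prod_ne_zero v)
  acyclic v := by
    have := (C.wellFounded_extendGate g).transGen
    exact this.irrefl.irrefl v

section extend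

variable (C : ArithCircuit F n) (g : Gate F n C.V) (hs : ∀ l, g = .sum l → l ≠ 0)
  (hp : ∀ l, g = .prod l → l ≠ 0)

/-- The gate `v` of `C` as a gate of the extended circuit. -/
def extendOld (v : C.V) : (C.extend g hs hp).V := some v

/-- The additional gate of the extended circuit. -/
def extendNew : (C.extend g hs hp).V := none

theorem gate_extendOld (v : C.V) : (C.extend g hs hp).gate (C.extendOld g hs hp v) =
    mapGate (C.extendOld g hs hp) (C.gate v) := rfl

theorem gate_extendNew : (C.extend g hs hp).gate (C.extendNew g hs hp) =
    mapGate (C.extendOld g hs hp) g := rfl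

theorem size_extend : (C.extend g hs hp).size = g.inputs.card + C.size := by
  let _ := C.fintypeV
  have h : (C.extend g hs hp).size =
      ∑ v : Option C.V, (C.extendGate g v).inputs.card := rfl
  rw [h, Fintype.sum_option]
  simp only [extendGate, inputs_mapGate, Multiset.card_map]
  rfl

theorem isOutput_extendNew : (C.extend g hs hp).IsOutput (C.extendNew g hs hp) := by
  have key : ∀ l : Multiset C.V, C.extendNew g hs hp ∉ l.map (C.extendOld g hs hp) := by
    intro l h
    obtain ⟨u, -, hu⟩ := Multiset.mem_map.1 h
    exact Option.some_ne_none _ hu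
  rintro (_ | w) h
  · exact key g.inputs (inputs_mapGate (C.extendOld g hs hp) g ▸ h)
  · exact key (C.gate w).inputs (inputs_mapGate (C.extendOld g hs hp) (C.gate w) ▸ h)

theorem eval_extendOld [Field F] (v : C.V) :
    (C.extend g hs hp).eval (C.extendOld g hs hp v) = C.eval v := by
  induction v using C.wellFounded_edge.induction with
  | _ v ih =>
  have hg' := C.gate_extendOld g hs hp v
  cases hg : C.gate v with
  | var i =>
    rw [hg] at hg'
    exact (eval_var _ hg').trans (eval_var _ hg).symm
  | const c =>
    rw [hg] at hg'
    exact (eval_const _ hg').trans (eval_const _ hg).symm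
  | sum l =>
    rw [hg] at hg'
    rw [eval_sum _ hg', eval_sum _ hg, Multiset.map_map]
    refine congrArg _ (Multiset.map_congr rfl fun u hu => ih u ?_)
    simpa [Edge, hg, Gate.inputs] using hu
  | prod l =>
    rw [hg] at hg'
    rw [eval_prod _ hg', eval_prod _ hg, Multiset.map_map]
    refine congrArg _ (Multiset.map_congr rfl fun u hu => ih u ?_)
    simpa [Edge, hg, Gate.inputs] using hu

end extend

variable [Field F]

theorem eval_extendNew_sum (C : ArithCircuit F n) (l : Multiset C.V) (hs) (hp) :
    (C.extend (.sum l) hs hp).eval (C.extendNew _ hs hp) = (l.map C.eval).sum := by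
  rw [eval_sum _ (C.gate_extendNew (.sum l) hs hp), Multiset.map_map]
  exact congrArg _ (Multiset.map_congr rfl fun u _ => eval_extendOld C _ hs hp u)

theorem eval_extendNew_prod (C : ArithCircuit F n) (l : Multiset C.V) (hs) (hp) :
    (C.extend (.prod l) hs hp).eval (C.extendNew _ hs hp) = (l.map C.eval).prod := by
  rw [eval_prod _ (C.gate_extendNew (.prod l) hs hp), Multiset.map_map]
  exact congrArg _ (Multiset.map_congr rfl fun u _ => eval_extendOld C _ hs hp u)

/-- A circuit without edges that contains finitely many given variables and constants. -/
theorem exists_of_subset_inputPolys (A : Finset (MvPolynomial (Fin n) F))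
    (hA : ↑A ⊆ inputPolys F n) :
    ∃ C : ArithCircuit F n, C.size = 0 ∧ ∀ p ∈ A, ∃ v, C.eval v = p := by
  have hex : ∀ p ∈ A, ∃ g : Gate F n (Fin A.card),
      (∃ i, g = .var i ∧ p = MvPolynomial.X i) ∨ (∃ c, g = .const c ∧ p = MvPolynomial.C c) := by
    intro p hp
    rcases hA hp with ⟨i, rfl⟩ | ⟨c, rfl⟩
    · exact ⟨.var i, .inl ⟨i, rfl, rfl⟩⟩
    · exact ⟨.const c, .inr ⟨c, rfl, rfl⟩⟩
  choose γ hγ using hex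
  have hin : ∀ p hp, (γ p hp).inputs = 0 := by
    intro p hp
    rcases hγ p hp with ⟨i, h, -⟩ | ⟨c, h, -⟩ <;> simp [h, Gate.inputs]
  let C : ArithCircuit F n :=
    { V := Fin A.card
      fintypeV := inferInstance
      gate := fun v => γ (A.equivFin.symm v) (A.equivFin.symm v).2
      sum_ne_zero := fun v l h => by
        rcases hγ _ (A.equivFin.symm v).2 with ⟨i, h', -⟩ | ⟨c, h', -⟩ <;> simp [h'] at h
      prod_ne_zero := fun v l h => by
        rcases hγ _ (A.equivFin.symm v).2 with ⟨i, h', -⟩ | ⟨c, h', -⟩ <;> simp [h'] at h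
      acyclic := fun v hv => by
        obtain ⟨u, -, hu⟩ := Relation.TransGen.tail'_iff.1 hv
        simp [hin] at hu }
  refine ⟨C, ?_, fun p hp => ⟨A.equivFin ⟨p, hp⟩, ?_⟩⟩
  · exact Finset.sum_eq_zero fun v _ => by rw [hin]; rfl
  · have hg : C.gate (A.equivFin ⟨p, hp⟩) = γ p hp := by simp [C]
    rcases hγ p hp with ⟨i, h', e⟩ | ⟨c, h', e⟩
    · rw [eval_var _ (hg.trans h'), e]
    · rw [eval_const _ (hg.trans h'), e]

/-- A chain of `m` operations is carried out by a circuit with at most `2 * m` edges. The chain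
starts from the infinite set of all constants, hence the restriction to a finite part `A`. -/
theorem exists_of_chain {m : ℕ} {T : Set (MvPolynomial (Fin n) F)}
    (h : Chain (inputPolys F n) m T) (A : Finset (MvPolynomial (Fin n) F)) (hA : ↑A ⊆ T) :
    ∃ C : ArithCircuit F n, C.size ≤ 2 * m ∧ ∀ p ∈ A, ∃ v, C.eval v = p := by
  classical
  induction h generalizing A with
  | refl =>
    obtain ⟨C, h0, hC⟩ := exists_of_subset_inputPolys A hA
    exact ⟨C, by omega, hC⟩
  | @add m T a b _ ha hb ih =>
    obtain ⟨C, hC, hev⟩ := ih (insert a (insert b (A.erase (a + b)))) <| by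
      intro p hp
      simp only [Finset.coe_insert, Finset.coe_erase, Set.mem_insert_iff, Set.mem_sdiff] at hp
      rcases hp with rfl | rfl | ⟨hp, hne⟩
      · exact ha
      · exact hb
      · exact (hA hp).resolve_left hne
    obtain ⟨u, hu⟩ := hev a (by simp)
    obtain ⟨w, hw⟩ := hev b (by simp)
    refine ⟨C.extend (.sum {u, w}) (by rintro l ⟨⟩; simp) (by rintro l ⟨⟩), ?_, fun p hp => ?_⟩
    · rw [size_extend]
      simp only [Gate.inputs, Multiset.card_pair]
      omega
    · by_cases h : p = a + b
      · exact ⟨C.extendNew _ _ _, by rw [eval_extendNew_sum]; simp [hu, hw, h]⟩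
      · obtain ⟨v, hv⟩ := hev p (by simp [h, hp])
        exact ⟨C.extendOld _ _ _ v, by rw [eval_extendOld, hv]⟩
  | @mul m T a b _ ha hb ih =>
    obtain ⟨C, hC, hev⟩ := ih (insert a (insert b (A.erase (a * b)))) <| by
      intro p hp
      simp only [Finset.coe_insert, Finset.coe_erase, Set.mem_insert_iff, Set.mem_sdiff] at hp
      rcases hp with rfl | rfl | ⟨hp, hne⟩
      · exact ha
      · exact hb
      · exact (hA hp).resolve_left hne
    obtain ⟨u, hu⟩ := hev a (by simp)
    obtain ⟨w, hw⟩ := hev b (by simp)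
    refine ⟨C.extend (.prod {u, w}) (by rintro l ⟨⟩) (by rintro l ⟨⟩; simp), ?_, fun p hp => ?_⟩
    · rw [size_extend]
      simp only [Gate.inputs, Multiset.card_pair]
      omega
    · by_cases h : p = a * b
      · exact ⟨C.extendNew _ _ _, by rw [eval_extendNew_prod]; simp [hu, hw, h]⟩
      · obtain ⟨v, hv⟩ := hev p (by simp [h, hp])
        exact ⟨C.extendOld _ _ _ v, by rw [eval_extendOld, hv]⟩

/-- In a downward closed set of gates every gate can be added after its inputs, so that the
operations needed are counted by the edges. -/
theorem derives_of_downwardClosed (C : ArithCircuit F n) (W : Finset C.V)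
    (hW : ∀ u w, C.Edge u w → w ∈ W → u ∈ W) :
    Derives (inputPolys F n) (∑ v ∈ W, (C.gate v).inputs.card) (C.eval '' W) := by
  classical
  have := C.fintypeV
  induction W using Finset.strongInduction with
  | H W ih =>
  rcases W.eq_empty_or_nonempty with rfl | hne
  · exact .of_subset (by simp)
  -- A gate of `W` without edges into other gates of `W` is removed and added last.
  have : Std.Irrefl (Relation.TransGen (flip C.Edge)) :=
    ⟨fun v hv => C.acyclic v (Relation.transGen_swap.1 hv)⟩
  have hwf : WellFounded (Relation.TransGen (flip C.Edge)) :=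
    Finite.wellFounded_of_trans_of_irrefl _
  obtain ⟨v, hv, hmax⟩ := hwf.has_min (W : Set C.V) hne
  have hmax' : ∀ w ∈ W, ¬ C.Edge v w := fun w hw hvw => hmax w hw (.single hvw)
  have key := ih (W.erase v) (Finset.erase_ssubset hv) fun u w huw hw =>
    Finset.mem_erase.2 ⟨fun h => hmax' w (Finset.mem_of_mem_erase hw) (h ▸ huw),
      hW u w huw (Finset.mem_of_mem_erase hw)⟩
  have hin : ∀ u ∈ (C.gate v).inputs, C.eval u ∈ inputPolys F n ∪ C.eval '' (W.erase v) :=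
    fun u hu => .inr ⟨u, Finset.mem_coe.2 (Finset.mem_erase.2
      ⟨fun h => C.acyclic v (.single (by rw [h] at hu; exact hu)), hW u v hu hv⟩), rfl⟩
  have h0 : (0 : MvPolynomial (Fin n) F) ∈ inputPolys F n := .inr ⟨0, by simp⟩
  have h1 : (1 : MvPolynomial (Fin n) F) ∈ inputPolys F n := .inr ⟨1, by simp⟩
  have step : Derives (inputPolys F n ∪ C.eval '' (W.erase v)) (C.gate v).inputs.card
      {C.eval v} := by
    cases hg : C.gate v with
    | var i => exact .of_mem (.inl (.inl ⟨i, (C.eval_var hg).symm⟩))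
    | const c => exact .of_mem (.inl (.inr ⟨c, (C.eval_const hg).symm⟩))
    | sum l =>
      rw [C.eval_sum hg]
      rw [hg] at hin
      refine (Derives.multiset_sum (.inl h0) (l.map C.eval) ?_).mono (by simp [Gate.inputs])
      simpa [Gate.inputs] using hin
    | prod l =>
      rw [C.eval_prod hg]
      rw [hg] at hin
      refine (Derives.multiset_prod (.inl h1) (l.map C.eval) ?_).mono (by simp [Gate.inputs])
      simpa [Gate.inputs] using hin
  refine ((key.trans step).mono ?_).subset ?_
  · rw [Finset.sum_erase_add _ _ hv]
  · rintro _ ⟨u, hu, rfl⟩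
    by_cases h : u = v
    · exact .inr (by simp [h])
    · exact .inl ⟨u, Finset.mem_coe.2 (Finset.mem_erase.2 ⟨h, hu⟩), rfl⟩

end ArithCircuit

theorem HasCircuitOfSize.derives {F : Type*} [Field F] {n s : ℕ} {f : MvPolynomial (Fin n) F}
    (h : HasCircuitOfSize f s) : Derives (inputPolys F n) s {f} := by
  obtain ⟨C, ⟨v, -, rfl⟩, hs⟩ := h
  have := C.fintypeV
  refine ((C.derives_of_downwardClosed Finset.univ (by simp)).mono ?_).subset (by simp)
  refine le_trans (le_of_eq ?_) hs
  unfold ArithCircuit.size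
  congr!

/-- The additional edge leads to a new gate with a single input, which makes `f` the polynomial of
an output gate. -/
theorem Derives.hasCircuitOfSize {F : Type*} [Field F] {n m : ℕ} {f : MvPolynomial (Fin n) F}
    (h : Derives (inputPolys F n) m {f}) : HasCircuitOfSize f (2 * m + 1) := by
  obtain ⟨k, hk, U, hU, hf⟩ := h
  obtain ⟨C, hC, hev⟩ := ArithCircuit.exists_of_chain hU {f} (by simpa using hf)
  obtain ⟨v, hv⟩ := hev f (by simp)
  refine ⟨C.extend (.sum {v}) (by rintro l ⟨⟩; simp) (by rintro l ⟨⟩),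
    ⟨C.extendNew _ _ _, ?_, ?_⟩, ?_⟩
  · exact C.isOutput_extendNew _ _ _
  · rw [ArithCircuit.eval_extendNew_sum]; simp [hv]
  · rw [ArithCircuit.size_extend]
    simp only [Gate.inputs, Multiset.card_singleton]
    omega

/-! ### Points at which a polynomial does not vanish -/

theorem exists_finset_card_eq {F : Type*} {m : ℕ} (hm : (m : ℕ∞) ≤ ENat.card F) :
    ∃ t : Finset F, t.card = m := by
  rw [← Set.encard_univ] at hm
  obtain ⟨t, -, ht⟩ := Set.exists_subset_encard_eq hm
  lift t to Finset F using Set.finite_of_encard_eq_coe ht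
  rw [Set.encard_coe_eq_coe_finsetCard] at ht
  exact ⟨t, by exact_mod_cast ht⟩

theorem MvPolynomial.exists_eval_ne_zero_of_totalDegree_lt_card {F : Type*} [Field F] {n : ℕ}
    {p : MvPolynomial (Fin n) F} (hp : p ≠ 0) (hF : (p.totalDegree : ℕ∞) < ENat.card F) :
    ∃ a : Fin n → F, eval a p ≠ 0 := by
  classical
  obtain ⟨t, ht'⟩ := exists_finset_card_eq (F := F) (m := p.totalDegree + 1)
    (by push_cast; exact Order.add_one_le_of_lt hF)
  by_contra! hall
  have hsz := schwartz_zippel_totalDegree hp t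
  rw [Finset.filter_true_of_mem fun a _ => hall a, Fintype.card_piFinset_const, ht'] at hsz
  have hpos : (0 : ℚ≥0) < ((p.totalDegree + 1 : ℕ) : ℚ≥0) := by positivity
  push_cast at hsz hpos
  rw [div_self (by positivity), le_div_iff₀ hpos, one_mul] at hsz
  exact absurd hsz (by simp)

/-! ### Resultants of coprime polynomials -/

namespace Polynomial

/-- Over a unique factorization domain, `P * v = -Q * u` with `deg u < deg P` forces `u = 0` if `P`
and `Q` have no common factor; hence the Sylvester map is injective. -/
theorem resultant_ne_zero_of_isRelPrime {A : Type*} [CommRing A] [IsDomain A]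
    [DecompositionMonoid A[X]] {P Q : A[X]} (hP : P ≠ 0) (h : IsRelPrime P Q) :
    resultant P Q ≠ 0 := by
  classical
  intro h0
  let b₁ := ((degreeLT.basis A P.natDegree).prod (degreeLT.basis A Q.natDegree)).reindex
    finSumFinEquiv
  let b₂ := degreeLT.basis A (P.natDegree + Q.natDegree)
  have hM := toMatrix_sylvesterMap' P Q le_rfl le_rfl
  obtain ⟨v, hv0, hv⟩ := Matrix.exists_mulVec_eq_zero_iff.2 h0
  obtain ⟨x, rfl⟩ : ∃ x, v = b₁.repr x := ⟨b₁.equivFun.symm v, by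
    rw [← b₁.equivFun_apply, LinearEquiv.apply_symm_apply]⟩
  rw [← hM, LinearMap.toMatrix_mulVec_repr] at hv
  have hx : sylvesterMap P Q le_rfl le_rfl x = 0 := by
    have : b₂.repr (sylvesterMap P Q le_rfl le_rfl x) = 0 := DFunLike.coe_injective hv
    simpa using this
  have heq : P * (x.2 : A[X]) + Q * (x.1 : A[X]) = 0 := congrArg Subtype.val hx
  have hdvd : P ∣ Q * (x.1 : A[X]) := ⟨-(x.2 : A[X]), by linear_combination heq⟩
  have hx1 : (x.1 : A[X]) = 0 := by
    refine eq_zero_of_dvd_of_degree_lt (h.dvd_of_dvd_mul_left hdvd) ?_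
    rw [degree_eq_natDegree hP]
    exact mem_degreeLT.1 x.1.2
  have hx2 : (x.2 : A[X]) = 0 := by
    rw [hx1, mul_zero, add_zero] at heq
    exact (mul_eq_zero.1 heq).resolve_left hP
  have : x = 0 := Prod.ext (Subtype.ext hx1) (Subtype.ext hx2)
  exact hv0 (by simp [this])

theorem totalDegree_resultant_le {F : Type*} [CommRing F] {σ : Type*}
    {P Q : (MvPolynomial σ F)[X]} {D : ℕ} (hP : ∀ j, (P.coeff j).totalDegree ≤ D)
    (hQ : ∀ j, (Q.coeff j).totalDegree ≤ D) :
    (resultant P Q).totalDegree ≤ (P.natDegree + Q.natDegree) * D := by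
  rw [resultant, Matrix.det_apply]
  refine MvPolynomial.totalDegree_finsetSum_le fun τ _ => ?_
  refine (MvPolynomial.totalDegree_smul_le _ _).trans ?_
  refine (MvPolynomial.totalDegree_finsetProd _ _).trans ?_
  refine (Finset.sum_le_card_nsmul _ _ D fun i _ => ?_).trans (by simp)
  rw [sylvester, Matrix.of_apply]
  refine Fin.addCases (fun j => ?_) (fun j => ?_) i
  · rw [Fin.addCases_left]; split_ifs <;> simp [hQ]
  · rw [Fin.addCases_right]; split_ifs <;> simp [hP]

end Polynomial

/-! ### Restriction to a line -/

/-- A homomorphism from a polynomial ring that sends variables to elements of degree at most one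
does not raise degrees. -/
theorem MvPolynomial.map_mem_of_filtration {F B σ : Type*} [CommRing F] [CommRing B] [Algebra F B]
    (W : ℕ → AddSubmonoid B) (hmono : Monotone W)
    (hmul : ∀ i j a b, a ∈ W i → b ∈ W j → a * b ∈ W (i + j))
    (hC : ∀ c, algebraMap F B c ∈ W 0) (ψ : MvPolynomial σ F →ₐ[F] B)
    (hX : ∀ i, ψ (X i) ∈ W 1) (g : MvPolynomial σ F) : ψ g ∈ W g.totalDegree := by
  have hmon : ∀ s : σ →₀ ℕ, ψ (monomial s 1) ∈ W s.degree := by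
    intro s
    induction s using Finsupp.induction_linear with
    | zero => simpa using hC 1
    | add s t hs ht =>
      rw [← one_mul (1 : F), ← monomial_mul, map_mul, map_add]
      exact hmul _ _ _ _ hs ht
    | single i k =>
      rw [← X_pow_eq_monomial, Finsupp.degree_single, map_pow]
      induction k with
      | zero => simpa using hC 1
      | succ k ih => rw [pow_succ]; exact hmul _ _ _ _ ih (hX i)
  rw [← g.support_sum_monomial_coeff, map_sum, g.support_sum_monomial_coeff]
  refine sum_mem fun s hs => ?_
  rw [← mul_one (g.coeff s), ← C_mul_monomial, map_mul, ← algebraMap_eq, AlgHom.commutes]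
  have := hmul _ _ _ _ (hC (g.coeff s)) (hmon s)
  rw [zero_add] at this
  refine hmono ?_ this
  exact le_totalDegree hs

open Polynomial in
/-- The line through the general point with direction `a`: `g` is sent to `g (x + y a)`, as a
polynomial in `y` with coefficients polynomials in `x`. -/
noncomputable def genericLine {F : Type*} [Field F] {n : ℕ} (a : Fin n → F) :
    MvPolynomial (Fin n) F →ₐ[F] (MvPolynomial (Fin n) F)[X] :=
  MvPolynomial.aeval fun i => C (MvPolynomial.X i) + C (MvPolynomial.C (a i)) * X

open Polynomial in
/-- The line through `b` with direction `a`: `g` is sent to `g (b + y a)`. -/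
noncomputable def line {F : Type*} [Field F] {n : ℕ} (b a : Fin n → F) :
    MvPolynomial (Fin n) F →ₐ[F] F[X] :=
  MvPolynomial.aeval fun i => C (b i) + C (a i) * X

section line

variable {F : Type*} [Field F] {n : ℕ} (a b : Fin n → F) (g h : MvPolynomial (Fin n) F)

open Polynomial

theorem map_eval_genericLine :
    (genericLine a g).map (MvPolynomial.eval b) = line b a g := by
  have : (Polynomial.mapRingHom (MvPolynomial.eval b)).comp (genericLine a).toRingHom =
      (line b a).toRingHom := by
    refine MvPolynomial.ringHom_ext (fun c => ?_) (fun i => ?_)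
    · simp [genericLine, line, Polynomial.algebraMap_eq, MvPolynomial.algebraMap_eq,
        IsScalarTower.algebraMap_apply F (MvPolynomial (Fin n) F) (MvPolynomial (Fin n) F)[X]]
    · simp [genericLine, line]
  exact congrArg (fun φ => φ g) this

theorem genericLine_coeff_totalDegree_le (j : ℕ) :
    ((genericLine a g).coeff j).totalDegree ≤ g.totalDegree ∧
      (g.totalDegree < j → (genericLine a g).coeff j = 0) := by
  refine MvPolynomial.map_mem_of_filtration (F := F) (B := (MvPolynomial (Fin n) F)[X])
    (fun N => ({ carrier := {P : (MvPolynomial (Fin n) F)[X] |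
                   ∀ j, (P.coeff j).totalDegree ≤ N ∧ (N < j → P.coeff j = 0)}
                 zero_mem' := by simp
                 add_mem' := ?_ } : AddSubmonoid _)) ?_ ?_ ?_ (genericLine a) ?_ g j
  · intro P Q hP hQ j
    rw [coeff_add]
    exact ⟨(MvPolynomial.totalDegree_add _ _).trans (max_le (hP j).1 (hQ j).1),
      fun hj => by rw [(hP j).2 hj, (hQ j).2 hj, add_zero]⟩
  · intro N M hNM P hP j
    exact ⟨(hP j).1.trans hNM, fun hj => (hP j).2 (hNM.trans_lt hj)⟩
  · intro N M P Q hP hQ j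
    rw [coeff_mul]
    refine ⟨MvPolynomial.totalDegree_finsetSum_le fun x _ =>
      (MvPolynomial.totalDegree_mul _ _).trans (add_le_add (hP _).1 (hQ _).1),
      fun hj => Finset.sum_eq_zero fun x hx => ?_⟩
    have := Finset.HasAntidiagonal.mem_antidiagonal.1 hx
    by_cases h : N < x.1
    · rw [(hP _).2 h, zero_mul]
    · rw [(hQ x.2).2 (by omega), mul_zero]
  · intro c j
    rw [IsScalarTower.algebraMap_apply F (MvPolynomial (Fin n) F) (MvPolynomial (Fin n) F)[X],
      Polynomial.algebraMap_eq, MvPolynomial.algebraMap_eq, coeff_C]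
    split_ifs with h <;> simp [h]
  · intro i j
    simp only [genericLine, MvPolynomial.aeval_X, coeff_add, coeff_C_mul, coeff_X, coeff_C]
    rcases j with _ | _ | j <;> simp

theorem natDegree_genericLine_le : (genericLine a g).natDegree ≤ g.totalDegree :=
  natDegree_le_iff_coeff_eq_zero.2 fun _ hj => (genericLine_coeff_totalDegree_le a g _).2 hj

theorem coeff_genericLine_monomial (s : Fin n →₀ ℕ) :
    (genericLine a (MvPolynomial.monomial s 1)).coeff s.degree =
      MvPolynomial.C (MvPolynomial.eval a (MvPolynomial.monomial s 1)) := by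
  have hdeg : ∀ s : Fin n →₀ ℕ,
      (genericLine a (MvPolynomial.monomial s 1)).natDegree ≤ s.degree := fun s =>
    (natDegree_genericLine_le a _).trans
      (MvPolynomial.totalDegree_monomial_le _ _)
  induction s using Finsupp.induction_linear with
  | zero => simp
  | add s t hs ht =>
    rw [← one_mul (1 : F), ← MvPolynomial.monomial_mul, map_mul, map_add,
      coeff_mul_add_eq_of_natDegree_le (hdeg s) (hdeg t), hs, ht, map_mul, map_mul]
  | single i k =>
    have h1 : (C (MvPolynomial.X i) + C (MvPolynomial.C (a i)) * X :
        (MvPolynomial (Fin n) F)[X]).natDegree ≤ 1 := by compute_degree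
    have := coeff_pow_of_natDegree_le (m := k) h1
    rw [mul_one] at this
    rw [← MvPolynomial.X_pow_eq_monomial, Finsupp.degree_single, map_pow, map_pow, map_pow,
      genericLine, MvPolynomial.aeval_X, this]
    simp

/-- The coefficient of `y ^ deg g` in `g (x + y a)` is the value at `a` of the leading form of `g`;
in particular it does not involve `x`. -/
theorem coeff_totalDegree_genericLine :
    (genericLine a g).coeff g.totalDegree =
      MvPolynomial.C (MvPolynomial.eval a (MvPolynomial.homogeneousComponent g.totalDegree g)) := by
  rw [MvPolynomial.homogeneousComponent_apply]
  conv_lhs => rw [← g.support_sum_monomial_coeff, map_sum, g.support_sum_monomial_coeff]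
  rw [finsetSum_coeff, map_sum, map_sum, Finset.sum_filter]
  refine Finset.sum_congr rfl fun s hs => ?_
  rw [← mul_one (g.coeff s), ← MvPolynomial.C_mul_monomial, map_mul, ← MvPolynomial.algebraMap_eq,
    AlgHom.commutes, IsScalarTower.algebraMap_apply F (MvPolynomial (Fin n) F)
      (MvPolynomial (Fin n) F)[X], Polynomial.algebraMap_eq, coeff_C_mul]
  have hle : s.degree ≤ g.totalDegree := MvPolynomial.le_totalDegree hs
  split_ifs with h
  · rw [← h, coeff_genericLine_monomial]
    simp [MvPolynomial.algebraMap_eq]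
  · rw [(genericLine_coeff_totalDegree_le a _ _).2, mul_zero]
    exact (MvPolynomial.totalDegree_monomial_le _ _).trans_lt (lt_of_le_of_ne hle h)

/-- The substitution `x ↦ x + y a` as an endomorphism of the polynomials in `x` and `y`. -/
noncomputable def shear : (MvPolynomial (Fin n) F)[X] →+* (MvPolynomial (Fin n) F)[X] :=
  Polynomial.eval₂RingHom (genericLine a).toRingHom X

theorem shear_C : shear a (C g) = genericLine a g := by
  simp [shear]

theorem shear_neg_comp_shear : (shear (-a)).comp (shear a) = RingHom.id _ := by
  refine Polynomial.ringHom_ext' (MvPolynomial.ringHom_ext (fun c => ?_) (fun i => ?_)) ?_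
  · simp [shear_C]
  · have hX : shear (-a) X = X := by simp [shear]
    have h2 : genericLine a (MvPolynomial.X i) =
      C (MvPolynomial.X i) + C (MvPolynomial.C (a i)) * X := by simp [genericLine]
    have h3 : genericLine (-a) (MvPolynomial.X i) =
      C (MvPolynomial.X i) - C (MvPolynomial.C (a i)) * X := by simp [genericLine]; ring
    simp [shear_C, h2, h3, hX]
  · simp [shear]

theorem shear_shear_neg (P : (MvPolynomial (Fin n) F)[X]) : shear a (shear (-a) P) = P := by
  have := congrArg (fun φ => φ P) (shear_neg_comp_shear (-a))
  simpa using this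

theorem shear_neg_shear (P : (MvPolynomial (Fin n) F)[X]) : shear (-a) (shear a P) = P := by
  simpa using shear_shear_neg (-a) P

variable {g h} in
/-- The substitution `x ↦ x + y a` is invertible, and a common divisor of two polynomials in `x`
has degree `0` in `y`. -/
theorem isRelPrime_genericLine (hgh : IsRelPrime g h) (hg : g ≠ 0) :
    IsRelPrime (genericLine a g) (genericLine a h) := by
  intro D hDg hDh
  have h1 : shear (-a) D ∣ C g := by
    rw [← shear_neg_shear a (C g), shear_C]; exact map_dvd (shear (-a)) hDg
  have h2 : shear (-a) D ∣ C h := by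
    rw [← shear_neg_shear a (C h), shear_C]; exact map_dvd (shear (-a)) hDh
  have hdeg : (shear (-a) D).natDegree = 0 := by
    have := natDegree_le_of_dvd h1 (C_ne_zero.2 hg)
    rw [natDegree_C] at this; omega
  obtain ⟨e, he⟩ := natDegree_eq_zero.1 hdeg
  rw [← he] at h1 h2
  have h1' := (C_dvd_iff_dvd_coeff e (C g)).1 h1 0
  have h2' := (C_dvd_iff_dvd_coeff e (C h)).1 h2 0
  rw [coeff_C_zero] at h1' h2'
  have hu : IsUnit e := hgh h1' h2'
  have : D = shear a (C e) := by rw [he, shear_shear_neg]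
  rw [this]
  exact (hu.map C).map (shear a)

variable {g h} in
/-- Some line meets `g` and `h` in coprime univariate polynomials of full degree: a direction `a`
off the zeros of the leading forms makes the restrictions to `x + y a` monic in `y` up to
constants, so that their resultant, which is of degree at most `d ^ 2` in `x`, specializes well. -/
theorem exists_line_isCoprime (hgh : IsRelPrime g h) (hg : 1 ≤ g.totalDegree)
    (hh : 1 ≤ h.totalDegree)
    (hF : (((g.totalDegree + h.totalDegree) ^ 2 : ℕ) : ℕ∞) < ENat.card F) :
    ∃ b a : Fin n → F, IsCoprime (line b a g) (line b a h) ∧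
      (line b a g).natDegree = g.totalDegree ∧ (line b a h).natDegree = h.totalDegree := by
  set p := g.totalDegree with hp
  set q := h.totalDegree with hq
  have hg0 : g ≠ 0 := by rintro rfl; simp at hp; omega
  have hh0 : h ≠ 0 := by rintro rfl; simp at hq; omega
  -- The leading form of a nonzero polynomial does not vanish.
  have htop : ∀ {f : MvPolynomial (Fin n) F}, f ≠ 0 →
      MvPolynomial.homogeneousComponent f.totalDegree f ≠ 0 := by
    intro f hf h0
    obtain ⟨s, hs, hs'⟩ := Finset.exists_mem_eq_sup f.support
      (MvPolynomial.support_nonempty.2 hf) fun s => s.sum fun _ e => e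
    have := congrArg (MvPolynomial.coeff s) h0
    rw [MvPolynomial.coeff_homogeneousComponent, if_pos (by exact hs'.symm)] at this
    exact MvPolynomial.mem_support_iff.1 hs (by simpa using this)
  have hprod := mul_ne_zero (htop hg0) (htop hh0)
  obtain ⟨a, ha⟩ := MvPolynomial.exists_eval_ne_zero_of_totalDegree_lt_card hprod <| by
    refine lt_of_le_of_lt ?_ hF
    norm_cast
    refine (MvPolynomial.totalDegree_mul _ _).trans ((add_le_add
      (MvPolynomial.homogeneousComponent_isHomogeneous _ _).totalDegree_le
      (MvPolynomial.homogeneousComponent_isHomogeneous _ _).totalDegree_le).trans ?_)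
    nlinarith
  rw [map_mul] at ha
  have hag := left_ne_zero_of_mul ha
  have hah := right_ne_zero_of_mul ha
  have hnat : ∀ {f : MvPolynomial (Fin n) F}, MvPolynomial.eval a
      (MvPolynomial.homogeneousComponent f.totalDegree f) ≠ 0 →
      (genericLine a f).natDegree = f.totalDegree := by
    intro f hf
    refine natDegree_eq_of_le_of_coeff_ne_zero (natDegree_genericLine_le a f) ?_
    rw [coeff_totalDegree_genericLine]
    exact MvPolynomial.C_ne_zero.2 hf
  have hnat' : ∀ (b) {f : MvPolynomial (Fin n) F}, MvPolynomial.eval a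
      (MvPolynomial.homogeneousComponent f.totalDegree f) ≠ 0 →
      (line b a f).natDegree = f.totalDegree := by
    intro b f hf
    rw [← map_eval_genericLine]
    refine natDegree_eq_of_le_of_coeff_ne_zero (natDegree_map_le.trans
      (natDegree_genericLine_le a f)) ?_
    rw [coeff_map, coeff_totalDegree_genericLine, MvPolynomial.eval_C]
    exact hf
  have hPg0 : genericLine a g ≠ 0 := by
    intro h0
    have := hnat hag
    rw [h0, natDegree_zero] at this
    omega
  -- The entries of the Sylvester matrix have degree at most `p + q`, and there are `p + q` rows.
  have hres := resultant_ne_zero_of_isRelPrime hPg0 (isRelPrime_genericLine a hgh hg0)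
  obtain ⟨b, hb⟩ := MvPolynomial.exists_eval_ne_zero_of_totalDegree_lt_card hres <| by
    refine lt_of_le_of_lt ?_ hF
    norm_cast
    refine (totalDegree_resultant_le (D := p + q)
      (fun j => (genericLine_coeff_totalDegree_le a g j).1.trans (by omega))
      (fun j => (genericLine_coeff_totalDegree_le a h j).1.trans (by omega))).trans ?_
    rw [hnat hag, hnat hah, sq]
  refine ⟨b, a, ?_, hnat' b hag, hnat' b hah⟩
  rw [← resultant_map_map, map_eval_genericLine, map_eval_genericLine, hnat hag, hnat hah,
    ← hnat' b hag, ← hnat' b hah] at hb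
  by_contra hnc
  refine hb (resultant_eq_zero_iff.2 ⟨.inl ?_, hnc⟩)
  intro h0
  have := hnat' b hag
  rw [h0, natDegree_zero] at this
  omega

end line

/-! ### Lifting a coprime factorization -/

namespace Polynomial

/-- If `P` and `Q` are coprime polynomials over a field, then `V` with `deg V < deg Q` can be
recovered from `P * V + Q * U` over any algebra: modulo `Q`, multiply by an inverse of `P`. The
coefficients of `V` are hence fixed linear combinations of those of `P * V + Q * U`. -/
theorem exists_coeff_eq_sum_of_isCoprime {F : Type*} [Field F] {P Q : F[X]} (hPQ : IsCoprime P Q)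
    (hQ : Q ≠ 0) (R : Type*) [CommRing R] [Algebra F R] (N : ℕ) :
    ∃ c : ℕ → ℕ → F, ∀ U V : R[X],
      (∀ j, Q.natDegree ≤ j → V.coeff j = 0) →
      (∀ j, N ≤ j → (P.map (algebraMap F R) * V + Q.map (algebraMap F R) * U).coeff j = 0) →
      ∀ i, V.coeff i = ∑ j ∈ Finset.range N, algebraMap F R (c i j) *
        (P.map (algebraMap F R) * V + Q.map (algebraMap F R) * U).coeff j := by
  obtain ⟨A, B, hAB⟩ := hPQ
  set Q' : F[X] := Q * C (Q.leadingCoeff⁻¹) with hQ'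
  have hmon : Q'.Monic := monic_mul_leadingCoeff_inv hQ
  refine ⟨fun i j => ((A * X ^ j) %ₘ Q').coeff i, fun U V hV hE i => ?_⟩
  nontriviality R
  set φ := algebraMap F R
  set E := P.map φ * V + Q.map φ * U with hEdef
  have hmon' : (Q'.map φ).Monic := hmon.map φ
  have hdegQ : (Q'.map φ).natDegree = Q.natDegree := by
    rw [hmon.natDegree_map, hQ', natDegree_mul_C (inv_ne_zero (leadingCoeff_ne_zero.2 hQ))]
  have hQd : Q'.map φ ∣ Q.map φ := by
    refine Polynomial.map_dvd φ ⟨C Q.leadingCoeff, ?_⟩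
    rw [hQ', mul_assoc, ← C_mul, inv_mul_cancel₀ (leadingCoeff_ne_zero.2 hQ), C_1, mul_one]
  have hAB' : A.map φ * P.map φ + B.map φ * Q.map φ = 1 := by
    rw [← Polynomial.map_mul, ← Polynomial.map_mul, ← Polynomial.map_add, hAB, Polynomial.map_one]
  have hVE : V = (A.map φ * E) %ₘ Q'.map φ := by
    have hlt : V.degree < (Q'.map φ).degree := by
      rw [degree_eq_natDegree hmon'.ne_zero, hdegQ]
      exact (degree_lt_iff_coeff_zero _ _).2 hV
    obtain ⟨K, hK⟩ := hQd
    have hmod : V %ₘ Q'.map φ = (A.map φ * E) %ₘ Q'.map φ := by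
      refine modByMonic_eq_of_dvd_sub hmon' ⟨K * (B.map φ * V - A.map φ * U), ?_⟩
      rw [← mul_assoc, ← hK, hEdef]
      linear_combination (-V) * hAB'
    rw [← hmod, (modByMonic_eq_self_iff hmon').2 hlt]
  have hsum : E = ∑ j ∈ Finset.range N, E.coeff j • X ^ j := by
    ext j
    rw [finsetSum_coeff]
    simp only [coeff_smul, coeff_X_pow, smul_eq_mul, mul_ite, mul_one, mul_zero,
      Finset.sum_ite_eq, Finset.mem_range]
    split_ifs with h
    · rfl
    · exact hE j (not_lt.1 h)
  rw [hVE, ← modByMonicHom_apply, hsum, Finset.mul_sum, map_sum, finsetSum_coeff, ← hsum]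
  refine Finset.sum_congr rfl fun j _ => ?_
  rw [mul_smul_comm, map_smul, modByMonicHom_apply, coeff_smul, smul_eq_mul, mul_comm,
    ← Polynomial.map_X φ, ← Polynomial.map_pow, ← Polynomial.map_mul, ← map_modByMonic φ hmon,
    coeff_map]

/-- One step of the lifting of a factorization `G * H`, in powers of the outer variable: the
coefficients of `H.coeff k` from those of lower order and those of `G * H`. -/
theorem derives_coeff_of_lt {F R : Type*} [Field F] [CommRing R] [Algebra F R] {S : Set R}
    (hS : Set.range (algebraMap F R) ⊆ S) {P Q : F[X]} (hPQ : IsCoprime P Q) (hQ : Q ≠ 0)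
    {G H : R[X][X]} (hG0 : G.coeff 0 = P.map (algebraMap F R))
    (hH0 : H.coeff 0 = Q.map (algebraMap F R))
    (hG : ∀ k j, P.natDegree < k + j → (G.coeff k).coeff j = 0)
    (hH : ∀ k j, Q.natDegree < k + j → (H.coeff k).coeff j = 0)
    {d k : ℕ} (hd : P.natDegree + Q.natDegree = d) (hk : 1 ≤ k) (hkd : k ≤ d)
    (hGH : ∀ j < d, ((G * H).coeff k).coeff j ∈ S)
    (hGS : ∀ k' < k, ∀ j < d, (G.coeff k').coeff j ∈ S)
    (hHS : ∀ k' < k, ∀ j < d, (H.coeff k').coeff j ∈ S) (i : ℕ) :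
    Derives S (d * ((d + 1) * (2 * (d + 1) + 1) + 4)) {(H.coeff k).coeff i} := by
  obtain ⟨c, hc⟩ := exists_coeff_eq_sum_of_isCoprime hPQ hQ R d
  have h0 : (0 : R) ∈ S := hS ⟨0, map_zero _⟩
  -- As `1 ≤ k`, both `H.coeff k` and `G.coeff k` are of lower degree than `Q` and `P`.
  have hE0 : ∀ j, d ≤ j → (P.map (algebraMap F R) * H.coeff k +
      Q.map (algebraMap F R) * G.coeff k).coeff j = 0 := by
    intro j hj
    rw [← hG0, ← hH0, coeff_add, coeff_mul, coeff_mul, Finset.sum_eq_zero, Finset.sum_eq_zero,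
      add_zero]
    · intro y hy
      have := Finset.HasAntidiagonal.mem_antidiagonal.1 hy
      by_cases h : Q.natDegree < y.1
      · rw [hH 0 _ (by omega), zero_mul]
      · rw [hG k _ (by omega), mul_zero]
    · intro y hy
      have := Finset.HasAntidiagonal.mem_antidiagonal.1 hy
      by_cases h : P.natDegree < y.1
      · rw [hG 0 _ (by omega), zero_mul]
      · rw [hH k _ (by omega), mul_zero]
  rw [hc (G.coeff k) (H.coeff k) (fun j hj => hH k j (by omega)) hE0 i]
  set A := (Finset.HasAntidiagonal.antidiagonal k).filter fun x : ℕ × ℕ =>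
    x.1 ≠ 0 ∧ x.2 ≠ 0 with hA
  -- The terms of the convolution at `(0, k)` and `(k, 0)` make up the left-hand side.
  have hE : P.map (algebraMap F R) * H.coeff k + Q.map (algebraMap F R) * G.coeff k =
      (G * H).coeff k - ∑ x ∈ A, G.coeff x.1 * H.coeff x.2 := by
    have hnot : (Finset.HasAntidiagonal.antidiagonal k).filter (fun x : ℕ × ℕ => ¬ (x.1 ≠ 0 ∧ x.2 ≠ 0)) =
        {(0, k), (k, 0)} := by
      ext ⟨x, y⟩
      simp only [Finset.mem_filter, Finset.HasAntidiagonal.mem_antidiagonal, Finset.mem_insert,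
        Finset.mem_singleton, Prod.mk.injEq]
      omega
    rw [coeff_mul, ← Finset.sum_filter_add_sum_filter_not _
      (fun x : ℕ × ℕ => x.1 ≠ 0 ∧ x.2 ≠ 0), hnot, Finset.sum_pair (by simp; omega), hG0, hH0]
    ring
  have hcoeff : ∀ j < d, Derives S ((d + 1) * (2 * (d + 1) + 1) + 2)
      {(P.map (algebraMap F R) * H.coeff k + Q.map (algebraMap F R) * G.coeff k).coeff j} := by
    intro j hj
    rw [hE, coeff_sub, finsetSum_coeff, sub_eq_add_neg, ← neg_one_mul]
    have hsum : Derives S ((d + 1) * (2 * (d + 1) + 1))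
        {∑ x ∈ A, (G.coeff x.1 * H.coeff x.2).coeff j} := by
      refine (Derives.sum (m := 2 * (d + 1)) A h0 fun x hx => ?_).mono ?_
      · rw [hA, Finset.mem_filter, Finset.HasAntidiagonal.mem_antidiagonal] at hx
        rw [coeff_mul]
        refine (Derives.sum (m := 1) _ h0 fun y hy => ?_).mono ?_
        · rw [Finset.HasAntidiagonal.mem_antidiagonal] at hy
          exact (Derives.of_mem (m := 0) (hGS _ (by omega) _ (by omega))).mul
            (Derives.of_mem (m := 0) (hHS _ (by omega) _ (by omega)))
        · rw [Finset.Nat.card_antidiagonal]; omega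
      · refine Nat.mul_le_mul_right _ ((Finset.card_filter_le _ _).trans ?_)
        rw [Finset.Nat.card_antidiagonal]; omega
    have hneg : Derives S 0 {(-1 : R)} := .of_mem (hS ⟨-1, by simp⟩)
    exact ((Derives.of_mem (m := 0) (hGH j hj)).add (hneg.mul hsum)).mono (by omega)
  refine (Derives.sum (m := (d + 1) * (2 * (d + 1) + 1) + 3) _ h0 fun j hj => ?_).mono ?_
  · exact ((Derives.of_mem (m := 0) (hS ⟨c i j, rfl⟩)).mul
      (hcoeff j (Finset.mem_range.1 hj))).mono (by omega)
  · rw [Finset.card_range]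

/-- Hensel lifting: if `G` and `H` are coprime at `0` and their terms of positive order do not
reach the degrees of `G` and `H` at `0`, then the coefficients of `G` and `H` are obtained from
those of `G * H`, order by order. -/
theorem derives_coeff_of_mul {F R : Type*} [Field F] [CommRing R] [Algebra F R] {S : Set R}
    (hS : Set.range (algebraMap F R) ⊆ S) {P Q : F[X]} (hPQ : IsCoprime P Q) (hP : P ≠ 0)
    (hQ : Q ≠ 0) {G H : R[X][X]} (hG0 : G.coeff 0 = P.map (algebraMap F R))
    (hH0 : H.coeff 0 = Q.map (algebraMap F R))
    (hG : ∀ k j, P.natDegree < k + j → (G.coeff k).coeff j = 0)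
    (hH : ∀ k j, Q.natDegree < k + j → (H.coeff k).coeff j = 0)
    {d : ℕ} (hd : P.natDegree + Q.natDegree = d)
    (hGH : ∀ k ≤ d, ∀ j < d, ((G * H).coeff k).coeff j ∈ S) {m : ℕ} (hm : m ≤ d + 1) :
    Derives S (m * (d * (2 * (d * ((d + 1) * (2 * (d + 1) + 1) + 4)))))
      (⋃ k ∈ Finset.range m, ⋃ j ∈ Finset.range d,
        ({(G.coeff k).coeff j} ∪ {(H.coeff k).coeff j})) := by
  induction m with
  | zero => exact .of_subset (by simp)
  | succ k ih =>
    set T := ⋃ k' ∈ Finset.range k, ⋃ j ∈ Finset.range d,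
        ({(G.coeff k').coeff j} ∪ {(H.coeff k').coeff j} : Set R) with hT
    have hGT : ∀ k' < k, ∀ j < d, (G.coeff k').coeff j ∈ S ∪ T := fun k' hk' j hj =>
      .inr (Set.mem_biUnion (Finset.mem_range.2 hk')
        (Set.mem_biUnion (Finset.mem_range.2 hj) (.inl rfl)))
    have hHT : ∀ k' < k, ∀ j < d, (H.coeff k').coeff j ∈ S ∪ T := fun k' hk' j hj =>
      .inr (Set.mem_biUnion (Finset.mem_range.2 hk')
        (Set.mem_biUnion (Finset.mem_range.2 hj) (.inr rfl)))
    have hST : Set.range (algebraMap F R) ⊆ S ∪ T := hS.trans Set.subset_union_left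
    rw [Finset.range_add_one, Finset.set_biUnion_insert, Set.union_comm, add_mul, one_mul]
    refine (ih (by omega)).trans ?_
    have := Derives.biUnion (S := S ∪ T) (Finset.range d)
      (T := fun j => {(G.coeff k).coeff j} ∪ {(H.coeff k).coeff j})
      (m := 2 * (d * ((d + 1) * (2 * (d + 1) + 1) + 4))) fun j hj => ?_
    · rwa [Finset.card_range] at this
    · rw [two_mul]
      rcases Nat.eq_zero_or_pos k with rfl | hk
      · refine (Derives.of_mem (hST ?_)).union (.of_mem (hST ?_))
        · exact ⟨P.coeff j, by rw [hG0, coeff_map]⟩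
        · exact ⟨Q.coeff j, by rw [hH0, coeff_map]⟩
      · refine Derives.union ?_ ?_
        · refine derives_coeff_of_lt hST hPQ.symm hP hH0 hG0 hH hG (by omega) hk (by omega)
            (fun j hj => .inl ?_) hHT hGT j
          rw [mul_comm]
          exact hGH k (by omega) j hj
        · exact derives_coeff_of_lt hST hPQ hQ hG0 hH0 hG hH hd hk (by omega)
            (fun j hj => .inl (hGH k (by omega) j hj)) hGT hHT j

/-! ### Interpolation -/

/-- The coefficients of a polynomial of degree at most `N` are linear combinations of its values at
`N + 1` distinct scalars, by the inverse of the Vandermonde matrix. -/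
theorem exists_coeff_eq_sum_eval {F : Type*} [Field F] {N : ℕ} {τ : Fin (N + 1) → F}
    (hτ : Function.Injective τ) :
    ∃ c : ℕ → Fin (N + 1) → F, ∀ (R : Type*) [CommRing R] [Algebra F R] (P : R[X]),
      (∀ j, N < j → P.coeff j = 0) → ∀ k ≤ N,
        P.coeff k = ∑ i, algebraMap F R (c k i) * P.eval (algebraMap F R (τ i)) := by
  have hdet : IsUnit (Matrix.vandermonde τ).det :=
    isUnit_iff_ne_zero.2 (Matrix.det_vandermonde_ne_zero_iff.2 hτ)
  refine ⟨fun k i => (Matrix.vandermonde τ)⁻¹ (Fin.ofNat (N + 1) k) i, fun R _ _ P hP k hk => ?_⟩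
  have hev : ∀ i, P.eval (algebraMap F R (τ i)) =
      ∑ j : Fin (N + 1), P.coeff j * algebraMap F R (Matrix.vandermonde τ i j) := by
    intro i
    rw [eval_eq_sum_range' (n := N + 1) (Nat.lt_succ_of_le (natDegree_le_iff_coeff_eq_zero.2 hP)),
      ← Fin.sum_univ_eq_sum_range fun j => P.coeff j * algebraMap F R (τ i) ^ j]
    simp [Matrix.vandermonde_apply]
  have hinv := Matrix.nonsing_inv_mul _ hdet
  have hkk : ((Fin.ofNat (N + 1) k : Fin (N + 1)) : ℕ) = k := Nat.mod_eq_of_lt (by omega)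
  simp_rw [hev, Finset.mul_sum]
  rw [Finset.sum_comm]
  have : ∀ j : Fin (N + 1), ∑ i, algebraMap F R ((Matrix.vandermonde τ)⁻¹ (Fin.ofNat (N + 1) k) i) *
      (P.coeff j * algebraMap F R (Matrix.vandermonde τ i j)) =
      if Fin.ofNat (N + 1) k = j then P.coeff j else 0 := by
    intro j
    have h := congrFun (congrFun hinv (Fin.ofNat (N + 1) k)) j
    rw [Matrix.mul_apply, Matrix.one_apply] at h
    have h' := congrArg (algebraMap F R) h
    rw [map_sum] at h'
    calc _ = P.coeff j * ∑ i, algebraMap F R ((Matrix.vandermonde τ)⁻¹ (Fin.ofNat (N + 1) k) i *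
          Matrix.vandermonde τ i j) := by
          rw [Finset.mul_sum]
          refine Finset.sum_congr rfl fun i _ => ?_
          rw [map_mul]; ring
      _ = _ := by rw [h']; split_ifs <;> simp
  rw [Finset.sum_congr rfl fun j _ => this j, Finset.sum_ite_eq, if_pos (Finset.mem_univ _), hkk]

end Polynomial

/-! ### The two-parameter family of substitutions -/

section plane

variable {F : Type*} [Field F] {n : ℕ} (b a : Fin n → F) (g : MvPolynomial (Fin n) F)

open Polynomial

/-- The substitution of `b + t (x - b) + y a` for `x`, as a polynomial in `t` with coefficients in
the polynomials in `y` over the polynomials in `x`: it restricts to the line through `b` with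
direction `a` at `t = 0`, and to the identity at `t = 1`, `y = 0`. -/
noncomputable def plane : MvPolynomial (Fin n) F →ₐ[F] (MvPolynomial (Fin n) F)[X][X] :=
  MvPolynomial.aeval fun i =>
    C (C (MvPolynomial.C (b i)) + C (MvPolynomial.C (a i)) * X) +
      X * C (C (MvPolynomial.X i - MvPolynomial.C (b i)))

/-- The substitution of `b + τ (x - b) + η a` for `x`, where `τ` and `η` are scalars. -/
noncomputable def planePoint (τ η : F) : MvPolynomial (Fin n) F →ₐ[F] MvPolynomial (Fin n) F :=
  MvPolynomial.aeval fun i =>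
    MvPolynomial.C τ * MvPolynomial.X i + MvPolynomial.C (b i - τ * b i + η * a i)

theorem coeff_plane_eq_zero (k j : ℕ) (h : g.totalDegree < k + j) :
    ((plane b a g).coeff k).coeff j = 0 := by
  let W : ℕ → AddSubmonoid (MvPolynomial (Fin n) F)[X][X] := fun N =>
    { carrier := {P | ∀ k j, N < k + j → (P.coeff k).coeff j = 0}
      zero_mem' := by simp
      add_mem' := fun {P Q} hP hQ k j h => by
        rw [coeff_add, coeff_add, hP k j h, hQ k j h, add_zero] }
  suffices plane b a g ∈ W g.totalDegree from this k j h
  refine MvPolynomial.map_mem_of_filtration (F := F) (B := (MvPolynomial (Fin n) F)[X][X])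
    W ?_ ?_ ?_ (plane b a) ?_ g
  · intro N M hNM P hP k j h
    exact hP k j (hNM.trans_lt h)
  · intro N M P Q hP hQ k j h
    rw [coeff_mul, finsetSum_coeff]
    refine Finset.sum_eq_zero fun x hx => ?_
    rw [coeff_mul]
    refine Finset.sum_eq_zero fun y hy => ?_
    have hx' := Finset.HasAntidiagonal.mem_antidiagonal.1 hx
    have hy' := Finset.HasAntidiagonal.mem_antidiagonal.1 hy
    by_cases h' : N < x.1 + y.1
    · rw [hP _ _ h', zero_mul]
    · rw [hQ x.2 y.2 (by omega), mul_zero]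
  · intro c k j h
    rw [IsScalarTower.algebraMap_apply F (MvPolynomial (Fin n) F)[X], Polynomial.algebraMap_eq,
      IsScalarTower.algebraMap_apply F (MvPolynomial (Fin n) F), Polynomial.algebraMap_eq]
    rcases k with _ | k
    · rcases j with _ | j
      · simp at h
      · simp [coeff_C]
    · simp
  · intro i k j h
    simp only [plane, MvPolynomial.aeval_X]
    rcases k with _ | _ | k
    · rcases j with _ | _ | j
      · simp at h
      · simp at h
      · simp [coeff_C, coeff_X]
    · rcases j with _ | j
      · simp at h
      · simp [coeff_C]
    · simp

theorem coeff_zero_plane :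
    (plane b a g).coeff 0 = (line b a g).map (algebraMap F (MvPolynomial (Fin n) F)) := by
  have : (Polynomial.constantCoeff (R := (MvPolynomial (Fin n) F)[X])).comp
      (plane b a).toRingHom =
      (Polynomial.mapRingHom (algebraMap F (MvPolynomial (Fin n) F))).comp
        (line b a).toRingHom := by
    refine MvPolynomial.ringHom_ext (fun c => ?_) (fun i => ?_)
    · simp [plane, line, IsScalarTower.algebraMap_apply F (MvPolynomial (Fin n) F)[X]
        (MvPolynomial (Fin n) F)[X][X], Polynomial.algebraMap_eq,
        IsScalarTower.algebraMap_apply F (MvPolynomial (Fin n) F) (MvPolynomial (Fin n) F)[X]]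
    · simp [plane, line, MvPolynomial.algebraMap_eq]
  exact congrArg (fun φ => φ g) this

theorem eval_eval_plane (τ η : F) :
    ((plane b a g).eval (algebraMap F _ τ)).eval (algebraMap F _ η) = planePoint b a τ η g := by
  have : ((Polynomial.evalRingHom (algebraMap F (MvPolynomial (Fin n) F) η)).comp
      (Polynomial.evalRingHom (algebraMap F (MvPolynomial (Fin n) F)[X] τ))).comp
      (plane b a).toRingHom = (planePoint b a τ η).toRingHom := by
    refine MvPolynomial.ringHom_ext (fun c => ?_) (fun i => ?_)
    · simp [plane, planePoint, IsScalarTower.algebraMap_apply F (MvPolynomial (Fin n) F)[X]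
        (MvPolynomial (Fin n) F)[X][X], Polynomial.algebraMap_eq,
        IsScalarTower.algebraMap_apply F (MvPolynomial (Fin n) F) (MvPolynomial (Fin n) F)[X],
        MvPolynomial.algebraMap_eq]
    · simp [plane, planePoint, MvPolynomial.algebraMap_eq,
        IsScalarTower.algebraMap_apply F (MvPolynomial (Fin n) F) (MvPolynomial (Fin n) F)[X]]
      ring
  exact congrArg (fun φ => φ g) this

theorem eq_sum_coeff_plane {d : ℕ} (hd : g.totalDegree ≤ d) :
    g = ∑ k ∈ Finset.range (d + 1), ((plane b a g).coeff k).coeff 0 := by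
  have h1 := eval_eval_plane b a g 1 0
  have hid : planePoint b a (1 : F) 0 = AlgHom.id F _ :=
    MvPolynomial.algHom_ext fun i => by simp [planePoint]
  rw [hid, AlgHom.id_apply, map_one, map_zero, ← coeff_zero_eq_eval_zero,
    eval_eq_sum_range' (n := d + 1), finsetSum_coeff] at h1
  · simpa using h1.symm
  · refine Nat.lt_succ_of_le (natDegree_le_iff_coeff_eq_zero.2 fun k hk => ?_)
    ext1 j
    rw [coeff_zero, coeff_plane_eq_zero b a g k j (by omega)]

variable {g}

theorem Derives.planePoint {s : ℕ} (hg : Derives (inputPolys F n) s {g}) (τ η : F) :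
    Derives (inputPolys F n) (n * 2 + s) {planePoint b a τ η g} := by
  have hC : ∀ c, MvPolynomial.C c ∈ inputPolys F n := fun c => .inr ⟨c, rfl⟩
  have hX : ∀ i, MvPolynomial.X i ∈ inputPolys F n := fun i => .inl ⟨i, rfl⟩
  have h1 := Derives.biUnion (S := inputPolys F n) (Finset.univ : Finset (Fin n))
    (T := fun i => {_root_.planePoint b a τ η (MvPolynomial.X i)}) (m := 2) fun i _ => by
      rw [_root_.planePoint, MvPolynomial.aeval_X]
      exact ((Derives.of_mem (m := 0) (hC τ)).mul (.of_mem (m := 0) (hX i))).add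
        (.of_mem (m := 0) (hC _))
  rw [Finset.card_univ, Fintype.card_fin] at h1
  refine (h1.trans ((hg.map (_root_.planePoint b a τ η).toRingHom).mono_left ?_)).subset ?_
  · rintro _ ⟨_, ⟨i, rfl⟩ | ⟨c, rfl⟩, rfl⟩
    · exact .inr (Set.mem_biUnion (Finset.mem_univ i) rfl)
    · refine .inl ?_
      have : (_root_.planePoint b a τ η).toRingHom (MvPolynomial.C c) = MvPolynomial.C c := by
        simp [_root_.planePoint, MvPolynomial.algebraMap_eq]
      rw [this]
      exact hC c
  · simp

/-- The coefficients of `plane b a g` are linear combinations of its values at `(d + 1) ^ 2` pairs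
of scalars, each of which is obtained from a derivation of `g` by substitution. -/
theorem Derives.coeff_plane {s d : ℕ} (hg : Derives (inputPolys F n) s {g})
    (hd : g.totalDegree ≤ d) (hF : ((d + 1 : ℕ) : ℕ∞) ≤ ENat.card F) {k j : ℕ} (hk : k ≤ d)
    (hj : j ≤ d) :
    Derives (inputPolys F n) ((d + 1) * ((d + 1) * (n * 2 + s + 2) + 2))
      {((plane b a g).coeff k).coeff j} := by
  obtain ⟨t, ht⟩ := exists_finset_card_eq hF
  have hinj : Function.Injective fun i => ((t.equivFinOfCardEq ht).symm i : F) :=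
    Subtype.val_injective.comp (Equiv.injective _)
  obtain ⟨c, hc⟩ := exists_coeff_eq_sum_eval hinj
  have hC : ∀ c, algebraMap F (MvPolynomial (Fin n) F) c ∈ inputPolys F n :=
    fun c => .inr ⟨c, rfl⟩
  have h0 : (0 : MvPolynomial (Fin n) F) ∈ inputPolys F n := .inr ⟨0, by simp⟩
  have hvan : ∀ k, d < k → (plane b a g).coeff k = 0 := fun k hk => by
    ext1 j
    rw [coeff_zero, coeff_plane_eq_zero b a g k j (by omega)]
  have hvan' : ∀ τ : F, ∀ j, d < j →
      ((plane b a g).eval (algebraMap F _ τ)).coeff j = 0 := fun τ j hj => by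
    rw [eval_eq_sum, Polynomial.sum, finsetSum_coeff]
    refine Finset.sum_eq_zero fun k _ => ?_
    rw [← map_pow, mul_comm, IsScalarTower.algebraMap_apply F (MvPolynomial (Fin n) F),
      Polynomial.algebraMap_eq, coeff_C_mul, coeff_plane_eq_zero b a g k j (by omega), mul_zero]
  rw [hc _ (plane b a g) hvan k hk, finsetSum_coeff]
  refine (Derives.sum (m := (d + 1) * (n * 2 + s + 2) + 1) _ h0 fun i _ => ?_).mono (by simp)
  rw [IsScalarTower.algebraMap_apply F (MvPolynomial (Fin n) F), Polynomial.algebraMap_eq,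
    coeff_C_mul, hc _ _ (hvan' _) j hj]
  refine ((Derives.of_mem (m := 0) (hC _)).mul
    ((Derives.sum (m := n * 2 + s + 1) _ h0 fun l _ => ?_))).mono (by simp)
  rw [eval_eval_plane]
  exact ((Derives.of_mem (m := 0) (hC _)).mul (hg.planePoint b a _ _)).mono (by omega)

end plane

/-- The bound on the number of operations that compute the factors: those for the coefficients of
the product by interpolation, those for the lifting, and those for the final sum. -/
def factorCost (s n d : ℕ) : ℕ :=
  (d + 1) * (d * ((d + 1) * ((d + 1) * (n * 2 + s + 2) + 2))) +
    (d + 1) * (d * (2 * (d * ((d + 1) * (2 * (d + 1) + 1) + 4)))) + (d + 1)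

/-- If the product of two coprime polynomials is derived from the input polynomials, then both
factors are, at polynomial cost: on a plane where they are coprime along a line, they are lifted
from that line. -/
theorem derives_factors {F : Type*} [Field F] {s n d : ℕ} {g h : MvPolynomial (Fin n) F}
    (hF : ((d ^ 2 : ℕ) : ℕ∞) < ENat.card F) (hd : (g * h).totalDegree = d)
    (hf : Derives (inputPolys F n) s {g * h}) (hg : 1 ≤ g.totalDegree) (hh : 1 ≤ h.totalDegree)
    (hgh : IsRelPrime g h) :
    Derives (inputPolys F n) (factorCost s n d) {g} ∧
      Derives (inputPolys F n) (factorCost s n d) {h} := by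
  have hg0 : g ≠ 0 := by rintro rfl; simp at hg
  have hh0 : h ≠ 0 := by rintro rfl; simp at hh
  have hsum : g.totalDegree + h.totalDegree = d := by
    rw [← hd, MvPolynomial.totalDegree_mul_of_isDomain hg0 hh0]
  obtain ⟨b, a, hcop, hgd, hhd⟩ := exists_line_isCoprime hgh hg hh (by rwa [hsum])
  have hF' : ((d + 1 : ℕ) : ℕ∞) ≤ ENat.card F := by
    refine le_trans ?_ (Order.add_one_le_of_lt hF)
    norm_cast
    nlinarith
  set T := ⋃ k ∈ Finset.range (d + 1), ⋃ j ∈ Finset.range d,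
    ({((plane b a (g * h)).coeff k).coeff j} : Set (MvPolynomial (Fin n) F)) with hT
  have h1 : Derives (inputPolys F n)
      ((d + 1) * (d * ((d + 1) * ((d + 1) * (n * 2 + s + 2) + 2)))) T := by
    have := Derives.biUnion (S := inputPolys F n) (Finset.range (d + 1))
      (T := fun k => ⋃ j ∈ Finset.range d,
        ({((plane b a (g * h)).coeff k).coeff j} : Set (MvPolynomial (Fin n) F)))
      (m := d * ((d + 1) * ((d + 1) * (n * 2 + s + 2) + 2))) fun k hk => by
        have := Derives.biUnion (S := inputPolys F n) (Finset.range d)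
          (T := fun j => ({((plane b a (g * h)).coeff k).coeff j} :
            Set (MvPolynomial (Fin n) F)))
          (m := (d + 1) * ((d + 1) * (n * 2 + s + 2) + 2)) fun j hj =>
            hf.coeff_plane b a hd.le hF' (by simpa [Nat.lt_succ_iff] using hk)
              (Finset.mem_range.1 hj).le
        rwa [Finset.card_range] at this
    rwa [Finset.card_range] at this
  have hconst : Set.range (algebraMap F (MvPolynomial (Fin n) F)) ⊆ inputPolys F n ∪ T := by
    rintro _ ⟨c, rfl⟩
    exact .inl (.inr ⟨c, rfl⟩)
  have hline0 : ∀ {f : MvPolynomial (Fin n) F}, 1 ≤ f.totalDegree →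
      (line b a f).natDegree = f.totalDegree → line b a f ≠ 0 := by
    intro f h1 h2 h0
    rw [h0, Polynomial.natDegree_zero] at h2
    omega
  have h2 := Polynomial.derives_coeff_of_mul (m := d + 1) hconst hcop (hline0 hg hgd)
    (hline0 hh hhd) (coeff_zero_plane b a g) (coeff_zero_plane b a h)
    (by rw [hgd]; exact coeff_plane_eq_zero b a g) (by rw [hhd]; exact coeff_plane_eq_zero b a h)
    (d := d) (by rw [hgd, hhd, hsum]) (fun k hk j hj => .inr <| by
      rw [← map_mul]
      exact Set.mem_biUnion (Finset.mem_range.2 (Nat.lt_succ_of_le hk))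
        (Set.mem_biUnion (Finset.mem_range.2 hj) rfl)) le_rfl
  have h12 := h1.trans h2
  have h0 : (0 : MvPolynomial (Fin n) F) ∈ inputPolys F n := .inr ⟨0, by simp⟩
  constructor
  · rw [eq_sum_coeff_plane b a g (d := d) (by omega)]
    refine (h12.trans ((Derives.sum (m := 0) _ (.inl h0) fun k hk => .of_mem ?_).mono
      (m' := d + 1) (by simp))).subset Set.subset_union_right
    exact .inr (.inr (Set.mem_biUnion hk
      (Set.mem_biUnion (Finset.mem_range.2 (by omega)) (.inl rfl))))
  · rw [eq_sum_coeff_plane b a h (d := d) (by omega)]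
    refine (h12.trans ((Derives.sum (m := 0) _ (.inl h0) fun k hk => .of_mem ?_).mono
      (m' := d + 1) (by simp))).subset Set.subset_union_right
    exact .inr (.inr (Set.mem_biUnion hk
      (Set.mem_biUnion (Finset.mem_range.2 (by omega)) (.inr rfl))))

open MvPolynomial in
/-- `factorCost` as a polynomial in `s`, `n` and `d`. -/
noncomputable def factorCostPoly : MvPolynomial (Fin 3) ℕ :=
  (X 2 + 1) * (X 2 * ((X 2 + 1) * ((X 2 + 1) * (X 1 * 2 + X 0 + 2) + 2))) +
    (X 2 + 1) * (X 2 * (2 * (X 2 * ((X 2 + 1) * (2 * (X 2 + 1) + 1) + 4)))) + (X 2 + 1)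

theorem eval_factorCostPoly (s n d : ℕ) :
    MvPolynomial.eval ![s, n, d] factorCostPoly = factorCost s n d := by
  simp [factorCostPoly, factorCost]

theorem lemma1p2 :
    ∃ Φ : MvPolynomial (Fin 3) ℕ,
      ∀ (F : Type*) [Field F] (s n d : ℕ) (f g h : MvPolynomial (Fin n) F),
        ((d ^ 2 : ℕ) : ℕ∞) < ENat.card F →
        f.totalDegree = d →
        HasCircuitOfSize f s →
        f = g * h →
        1 ≤ g.totalDegree →
        1 ≤ h.totalDegree →
        IsRelPrime g h →
        HasCircuitOfSize g (MvPolynomial.eval ![s, n, d] Φ) ∧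
          HasCircuitOfSize h (MvPolynomial.eval ![s, n, d] Φ) := by
  refine ⟨2 * factorCostPoly + 1, fun F _ s n d f g h hF hd hf hfgh hg hh hgh => ?_⟩
  subst hfgh
  have hev : MvPolynomial.eval ![s, n, d] (2 * factorCostPoly + 1) = 2 * factorCost s n d + 1 := by
    rw [map_add, map_mul, eval_factorCostPoly, map_one, map_ofNat]
  rw [hev]
  obtain ⟨h1, h2⟩ := derives_factors hF hd hf.derives hg hh hgh
  exact ⟨h1.hasCircuitOfSize, h2.hasCircuitOfSize⟩
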